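/- Let $n\ge 3$ be odd, let $X$ be a Cantor set (a nonempty, compact, metrizable, totally disconnected space without isolated points), let $\alpha : X\to X$ be a minimal homeomorphism (the only closed $F\subseteq X$ with $\alpha(F)=F$ are $\emptyset$ and $X$) and let $\beta : S^n\to S^n$ be a homeomorphism. Let $A=C(X\times S^n)\rtimes_{\alpha\times\beta}\mathbb{Z}$ be the crossed product C*-algebra, with canonical unitary $u$, so that $ufu^*=f\circ(\alpha\times\beta)^{-1}$ for $f\in C(X\times S^n)$. For $y\in X$ let $$A_{\{y\}}=\mathrm{C}^*\bigl(C(X\times S^n),\ u\,C_0((X\setminus\{y\})\times S^n)\bigr)\subseteq A$$ be the C*-subalgebra generated by $C(X\times S^n)$ and by the elements $uf$, where $f\in C(X\times S^n)$ vanishes on $\{y\}\times S^n$. Then for every $y\in X$ there is an increasing sequence $B_0\subseteq B_1\subseteq\cdots$ of C*-subalgebras of $A_{\{y\}}$ containing the unit, with dense union, such that for each $k$ there are finitely many integers $h_1,\dots,h_m\ge 1$ and nonempty clopen sets $U_1,\dots,U_m\subseteq X$ with $$B_k\cong\bigoplus_{i=1}^m M_{h_i}\bigl(C(U_i\times S^n)\bigr).$$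 Moreover, $A_{\{y\}}$ is an AH algebra with no dimension growth: there are a $d\in\mathbb{N}$ and an increasing sequence of C*-subalgebras of $A_{\{y\}}$ containing the unit, with dense union, each isomorphic to a finite direct sum $\bigoplus_i p_iM_{r_i}(C(Y_i))p_i$, where the $Y_i$ are compact metrizable spaces of covering dimension at most $d$ and $p_i\in M_{r_i}(C(Y_i))$ are projections. -/

import Mathlib

open scoped ENNReal

universe u v

noncomputable section

/-! ### Topological preliminaries -/

/-- A homeomorphism of `X` is minimal if the only closed invariant sets are `∅` and `X`. -/
def IsMinimalHomeo {X : Type u} [TopologicalSpace X] (α : X ≃ₜ X) : Prop :=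
  ∀ F : Set X, IsClosed F → α '' F = F → F = ∅ ∨ F = Set.univ

/-- The Lebesgue covering dimension of `Y` is at most `d`: every finite open cover has a finite open
refinement such that every point lies in at most `d + 1` of its members. -/
def CoveringDimLE (Y : Type u) [TopologicalSpace Y] (d : ℕ) : Prop :=
  ∀ C : Set (Set Y), C.Finite → (∀ U ∈ C, IsOpen U) → ⋃₀ C = Set.univ →
    ∃ D : Set (Set Y), D.Finite ∧ (∀ V ∈ D, IsOpen V) ∧ ⋃₀ D = Set.univ ∧
      (∀ V ∈ D, ∃ U ∈ C, V ⊆ U) ∧ ∀ y : Y, {V ∈ D | y ∈ V}.encard ≤ (d + 1 : ℕ)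

/-- The unit sphere `S^n` in `ℝ^(n+1)`. -/
abbrev UnitSphere (n : ℕ) : Type := Metric.sphere (0 : EuclideanSpace ℝ (Fin (n + 1))) 1

/-! ### The crossed product `C(Z) ⋊_γ ℤ` -/

/-- The separable infinite-dimensional Hilbert space `ℓ²(ℤ)`. -/
abbrev HilbertZ : Type := lp (fun _ : ℤ => ℂ) 2

/-- The C*-algebra of bounded operators on `ℓ²(ℤ)`. -/
abbrev BoundedOps : Type := HilbertZ →L[ℂ] HilbertZ

instance : Nontrivial HilbertZ :=
  ⟨⟨lp.single 2 (0 : ℤ) (1 : ℂ), 0, fun h => by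
    have h0 := congrArg (fun x : HilbertZ => x 0) h
    simp at h0⟩⟩

section CrossedProduct

variable {Z : Type u} [TopologicalSpace Z] [CompactSpace Z]

/-- The composition operator `f ↦ f ∘ γ⁻¹`, the automorphism of `C(Z)` induced by `γ`. -/
def pullInv (γ : Z ≃ₜ Z) (f : C(Z, ℂ)) : C(Z, ℂ) := f.comp (γ.symm : C(Z, Z))

/-- A covariant representation of `(C(Z), γ)` on `ℓ²(ℤ)`: a unital representation `π` of `C(Z)` and
a unitary `U` with `U π(f) U* = π(f ∘ γ⁻¹)`. -/
structure CovariantRep (γ : Z ≃ₜ Z) : Type u where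
  /-- the representation of `C(Z)` -/
  π : C(Z, ℂ) →⋆ₐ[ℂ] BoundedOps
  /-- the implementing unitary -/
  U : BoundedOps
  unitary_U : U ∈ unitary BoundedOps
  covariant : ∀ f : C(Z, ℂ), U * π f * star U = π (pullInv γ f)

/-- The C*-algebra of bounded families of operators indexed by the covariant representations. -/
abbrev RepProduct (γ : Z ≃ₜ Z) : Type u := lp (fun _ : CovariantRep γ => BoundedOps) ∞

instance (γ : Z ≃ₜ Z) : CStarAlgebra (RepProduct γ) where

/-- The value at `f ∈ C(Z)` of the direct sum of all covariant representations. -/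
def repFun (γ : Z ≃ₜ Z) (f : C(Z, ℂ)) : RepProduct γ :=
  ⟨fun ρ => ρ.π f, memℓp_infty ⟨‖f‖, by
    rintro _ ⟨ρ, rfl⟩
    exact NonUnitalStarAlgHom.norm_apply_le ρ.π f⟩⟩

/-- The direct sum of the implementing unitaries of all covariant representations. -/
def repUnitary (γ : Z ≃ₜ Z) : RepProduct γ :=
  ⟨fun ρ => ρ.U, memℓp_infty ⟨1, by
    rintro _ ⟨ρ, rfl⟩
    exact (CStarRing.norm_of_mem_unitary ρ.unitary_U).le⟩⟩

/-- The image of `C(Z) ⋊_γ ℤ` under the direct sum of all covariant representations on `ℓ²(ℤ)`: the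
C*-algebra generated by the image of `C(Z)` and by the implementing unitary. -/
def crossedProductSubalgebra (γ : Z ≃ₜ Z) : StarSubalgebra ℂ (RepProduct γ) :=
  (StarAlgebra.adjoin ℂ (Set.range (repFun γ) ∪ {repUnitary γ})).topologicalClosure

instance (γ : Z ≃ₜ Z) : IsClosed (crossedProductSubalgebra γ : Set (RepProduct γ)) :=
  StarSubalgebra.isClosed_topologicalClosure _

/-- The (full) crossed product C*-algebra `C(Z) ⋊_γ ℤ` of a homeomorphism `γ` of a compact
metrizable space `Z`, i.e. the completion of the finitely supported functions `ℤ → C(Z)` in the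
supremum of the seminorms given by the covariant representations. As `C(Z)` is separable, this
supremum is attained already on the covariant representations on a fixed separable
infinite-dimensional Hilbert space: cyclic ones live on separable spaces, and a countable multiple
of a nonzero one lives on `ℓ²(ℤ)`. -/
abbrev CrossedProduct (γ : Z ≃ₜ Z) : Type u := crossedProductSubalgebra γ

/-- The canonical embedding `C(Z) → C(Z) ⋊_γ ℤ`. -/
def CrossedProduct.ofFun (γ : Z ≃ₜ Z) (f : C(Z, ℂ)) : CrossedProduct γ :=
  ⟨repFun γ f, StarSubalgebra.le_topologicalClosure _
    (StarAlgebra.subset_adjoin ℂ _ (Or.inl ⟨f, rfl⟩))⟩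

/-- The canonical unitary of `C(Z) ⋊_γ ℤ`. -/
def CrossedProduct.unitary (γ : Z ≃ₜ Z) : CrossedProduct γ :=
  ⟨repUnitary γ, StarSubalgebra.le_topologicalClosure _
    (StarAlgebra.subset_adjoin ℂ _ (Or.inr rfl))⟩

/-- The canonical unitary implements `γ`: `u f u* = f ∘ γ⁻¹`. -/
theorem CrossedProduct.covariance (γ : Z ≃ₜ Z) (f : C(Z, ℂ)) :
    CrossedProduct.unitary γ * CrossedProduct.ofFun γ f * star (CrossedProduct.unitary γ) =
      CrossedProduct.ofFun γ (pullInv γ f) := by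
  apply Subtype.ext
  apply Subtype.ext
  funext ρ
  exact ρ.covariant f

end CrossedProduct

/-! ### The orbit breaking subalgebra -/

section OrbitBreaking

variable {X : Type u} [TopologicalSpace X] [CompactSpace X] {S : Type} [TopologicalSpace S]
  [CompactSpace S]

/-- For `Y ⊆ X` closed, the C*-subalgebra `C*(C(X × S), u C₀((X ∖ Y) × S))` of the crossed product
of `C(X × S)` by `α × β`; here `C₀((X ∖ Y) × S)` is the ideal of the functions in `C(X × S)` that
vanish on `Y × S`. -/
def orbitBreaking (α : X ≃ₜ X) (β : S ≃ₜ S) (Y : Set X) :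
    StarSubalgebra ℂ (CrossedProduct (α.prodCongr β)) :=
  (StarAlgebra.adjoin ℂ
    (Set.range (CrossedProduct.ofFun (α.prodCongr β)) ∪
      {a | ∃ f : C(X × S, ℂ), (∀ x ∈ Y, ∀ s : S, f (x, s) = 0) ∧
        a = CrossedProduct.unitary (α.prodCongr β) *
          CrossedProduct.ofFun (α.prodCongr β) f})).topologicalClosure

instance (α : X ≃ₜ X) (β : S ≃ₜ S) (Y : Set X) :
    IsClosed (orbitBreaking α β Y : Set (CrossedProduct (α.prodCongr β))) :=
  StarSubalgebra.isClosed_topologicalClosure _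

end OrbitBreaking

/-! ### Inductive limits and AH algebras -/

section InductiveLimit

/-- The unital C*-algebra `A` is the inductive limit of an increasing sequence `B 0 ⊆ B 1 ⊆ ⋯` of
C*-subalgebras (containing the unit), that is, their union is dense. -/
structure IsInductiveLimit (A : Type u) [CStarAlgebra A] (B : ℕ → StarSubalgebra ℂ A) : Prop where
  isClosed : ∀ k, IsClosed (B k : Set A)
  monotone : Monotone B
  dense : Dense (⋃ k, (B k : Set A))

/-- The C*-algebra `⊕ᵢ M_{r i}(C(Y i))`, a finite direct sum. -/
abbrev MatrixSum {m : ℕ} (r : Fin m → ℕ) (Y : Fin m → Type u) [∀ i, TopologicalSpace (Y i)] :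
    Type u :=
  ∀ i : Fin m, CStarMatrix (Fin (r i)) (Fin (r i)) C(Y i, ℂ)

/-- `B` is *-isomorphic to a finite direct sum `⊕ᵢ pᵢ M_{rᵢ}(C(Yᵢ)) pᵢ`, where the `Yᵢ` are compact
metrizable spaces of covering dimension at most `d` and the `pᵢ` are projections. The isomorphism
is given as an injective *-homomorphism `φ` into `⊕ᵢ M_{rᵢ}(C(Yᵢ))` with image `p (⋯) p`. -/
def IsHomogeneousSumOfDimLE (d : ℕ) {A : Type u} [CStarAlgebra A] (B : StarSubalgebra ℂ A) : Prop :=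
  ∃ (m : ℕ) (r : Fin m → ℕ) (Y : Fin m → Type u) (_ : ∀ i, TopologicalSpace (Y i)),
    (∀ i, CompactSpace (Y i) ∧ TopologicalSpace.MetrizableSpace (Y i) ∧ CoveringDimLE (Y i) d) ∧
    ∃ p : MatrixSum r Y, IsStarProjection p ∧
      ∃ φ : B →⋆ₙₐ[ℂ] MatrixSum r Y, Function.Injective φ ∧ Set.range φ = {a | p * a * p = a}

/-- `A` is an AH algebra with no dimension growth: an inductive limit of finite direct sums of
algebras `p M_r(C(Y)) p` with `Y` compact metrizable, for which the dimensions of all the spaces `Y`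
that occur have a common finite bound. Quotients of such direct sums are again of this form (with
closed subspaces of the `Y`), hence the building blocks may be taken to be subalgebras of `A`; if
`A` is unital, then they contain its unit from some index on. -/
def IsAHNoDimGrowth (A : Type u) [CStarAlgebra A] : Prop :=
  ∃ (d : ℕ) (B : ℕ → StarSubalgebra ℂ A), IsInductiveLimit A B ∧
    ∀ k, IsHomogeneousSumOfDimLE d (B k)

end InductiveLimit

end

/-! Breaking the orbit at a clopen set `Y` instead of a point gives an algebra that can be computed
exactly. By minimality and compactness every point enters `Y` within a bounded time, so sorting the
points of `α(Y)` by their first entry time into `Y` cuts `X` into finitely many clopen towers whose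
top levels fill `Y` (`IsMinimalHomeo.nonempty_towerPartition`). If `f` vanishes over `Y`, then `u f`
only moves a level to the next one in the same tower and never leaves through the top. Hence the
elements `u ^ j g u ^ (-k)`, with `g` supported over a base `U i` and `j, k < h i`, multiply like
matrix units with coefficients in `C(U i × S)`, and their sums exhaust the algebra of `Y`
(`TowerPartition.range_towerHom`). The map from the matrix sum is injective: compressing to a corner
recovers each entry, and `C(Z)` embeds in the crossed product by the regular representations along
orbits. Being isometric, it has closed range, so no completion is needed at this stage.

Now let `Y` shrink through a clopen neighbourhood basis of `y`. The algebras increase, and their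
union is dense because, `S` being compact, a function vanishing over `y` is a uniform limit of
functions vanishing over neighbourhoods of `y` (`orbitBreaking_singleton_le`). The same sequence
shows that there is no dimension growth, since all `U × S^n` with `U` clopen obey one dimension
bound (`coveringDimLE_prod_unitSphere`). -/

/-! ### Regular representations -/

/-- The shift by `k` on `ℓ²(ℤ)`. -/
noncomputable def shiftOp (k : ℤ) : BoundedOps :=
  haveI hp : (0 : ℝ) < (2 : ℝ≥0∞).toReal := by norm_num
  LinearMap.mkContinuous
    { toFun := fun x => ⟨fun m => x (m - k), (memℓp_gen_iff hp).2
        ((Equiv.subRight k).summable_iff.2 ((memℓp_gen_iff hp).1 (lp.memℓp x)))⟩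
      map_add' := fun _ _ => rfl
      map_smul' := fun _ _ => rfl }
    1
    fun x => by
      rw [one_mul, lp.norm_eq_tsum_rpow hp, lp.norm_eq_tsum_rpow hp]
      refine le_of_eq ?_
      congr 1
      exact (Equiv.subRight k).tsum_eq (fun m => ‖x m‖ ^ (2 : ℝ≥0∞).toReal)

theorem shiftOp_apply (k : ℤ) (x : HilbertZ) (m : ℤ) : shiftOp k x m = x (m - k) := rfl

theorem star_shiftOp (k : ℤ) : star (shiftOp k) = shiftOp (-k) := by
  rw [ContinuousLinearMap.star_eq_adjoint]
  refine Eq.symm ((ContinuousLinearMap.eq_adjoint_iff _ _).2 fun x y => ?_)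
  rw [lp.inner_eq_tsum, lp.inner_eq_tsum, ← (Equiv.subRight k).tsum_eq]
  refine tsum_congr fun m => ?_
  simp [shiftOp_apply]

/-- The diagonal operator on `ℓ²(ℤ)` given by a bounded sequence. -/
noncomputable def diagOp (c : ℤ → ℂ) (K : ℝ) (hc : ∀ m, ‖c m‖ ≤ K) : BoundedOps :=
  lp.mapCLM 2 (fun m => c m • ContinuousLinearMap.id ℂ ℂ) (K := K)
    ((norm_nonneg _).trans (hc 0)) (fun m => by simpa [norm_smul] using hc m)

theorem diagOp_apply (c : ℤ → ℂ) (K : ℝ) (hc : ∀ m, ‖c m‖ ≤ K) (x : HilbertZ) (m : ℤ) :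
    diagOp c K hc x m = c m * x m := rfl

theorem star_diagOp (c : ℤ → ℂ) (K : ℝ) (hc : ∀ m, ‖c m‖ ≤ K) :
    star (diagOp c K hc) = diagOp (fun m => star (c m)) K (fun m => by simpa using hc m) := by
  rw [ContinuousLinearMap.star_eq_adjoint]
  refine Eq.symm ((ContinuousLinearMap.eq_adjoint_iff _ _).2 fun x y => ?_)
  rw [lp.inner_eq_tsum, lp.inner_eq_tsum]
  refine tsum_congr fun m => ?_
  simp only [diagOp_apply, RCLike.inner_apply, map_mul, starRingEnd_apply, star_star]
  ring

theorem boundedOps_ext {S T : BoundedOps} (h : ∀ x m, S x m = T x m) : S = T :=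
  ContinuousLinearMap.ext fun x => lp.ext (funext (h x))

section CrossedProduct

variable {Z : Type u} [TopologicalSpace Z] [CompactSpace Z]

/-- The representation of `C(Z)` on `ℓ²(ℤ)` by the values of functions along the orbit of `z`. -/
noncomputable def orbitRep (γ : Z ≃ₜ Z) (z : Z) : C(Z, ℂ) →⋆ₐ[ℂ] BoundedOps where
  toFun f := diagOp (fun m => f ((γ ^ m) z)) ‖f‖ fun _ => f.norm_coe_le_norm _
  map_one' := boundedOps_ext fun x m => by simp [diagOp_apply]
  map_mul' f g := boundedOps_ext fun x m => by simp [diagOp_apply, mul_assoc]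
  map_zero' := boundedOps_ext fun x m => by simp [diagOp_apply]
  map_add' f g := boundedOps_ext fun x m => by simp [diagOp_apply, add_mul]
  commutes' r := boundedOps_ext fun x m => by
    simp [diagOp_apply, Algebra.algebraMap_eq_smul_one]
  map_star' f := by
    rw [star_diagOp]
    exact boundedOps_ext fun x m => by simp [diagOp_apply]

theorem orbitRep_apply (γ : Z ≃ₜ Z) (z : Z) (f : C(Z, ℂ)) (x : HilbertZ) (m : ℤ) :
    orbitRep γ z f x m = f ((γ ^ m) z) * x m := rfl

/-- The regular covariant representation on the orbit of `z`. -/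
noncomputable def regularRep (γ : Z ≃ₜ Z) (z : Z) : CovariantRep γ where
  π := orbitRep γ z
  U := shiftOp 1
  unitary_U := by
    rw [Unitary.mem_iff, star_shiftOp]
    constructor <;> exact boundedOps_ext fun x m => by simp [shiftOp_apply]
  covariant f := by
    rw [star_shiftOp]
    refine boundedOps_ext fun x m => ?_
    -- Conjugation by the shift puts the value of `f` at index `m - 1` of the orbit into position
    -- `m`.
    have h : (γ ^ (m - 1)) z = γ.symm ((γ ^ m) z) := by
      rw [show m - 1 = -1 + m by ring, zpow_add, zpow_neg_one]; rfl
    simp [shiftOp_apply, orbitRep_apply, pullInv, h]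

/-- The canonical embedding of `C(Z)` into the crossed product, as a `*`-homomorphism. -/
noncomputable def CrossedProduct.ofFunHom (γ : Z ≃ₜ Z) : C(Z, ℂ) →⋆ₐ[ℂ] CrossedProduct γ where
  toFun := CrossedProduct.ofFun γ
  map_one' := Subtype.ext (Subtype.ext (funext fun ρ => map_one ρ.π))
  map_mul' f g := Subtype.ext (Subtype.ext (funext fun ρ => map_mul ρ.π f g))
  map_zero' := Subtype.ext (Subtype.ext (funext fun ρ => map_zero ρ.π))
  map_add' f g := Subtype.ext (Subtype.ext (funext fun ρ => map_add ρ.π f g))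
  commutes' r := Subtype.ext (Subtype.ext (funext fun ρ => AlgHomClass.commutes ρ.π r))
  map_star' f := Subtype.ext (Subtype.ext (funext fun ρ => map_star ρ.π f))

/-- The value `f z` is the diagonal entry at index `0` of `f` in the regular representation on the
orbit of `z`. -/
theorem CrossedProduct.ofFunHom_injective (γ : Z ≃ₜ Z) :
    Function.Injective (CrossedProduct.ofFunHom γ) := by
  refine (injective_iff_map_eq_zero _).2 fun f hf => ContinuousMap.ext fun z => ?_
  have h1 : (regularRep γ z).π f = 0 :=
    congrArg (fun a : CrossedProduct γ => (a : RepProduct γ) (regularRep γ z)) hf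
  have h2 : orbitRep γ z f (lp.single 2 0 1) 0 = 0 := by
    rw [show orbitRep γ z f = 0 from h1]; rfl
  simpa [orbitRep_apply] using h2

theorem CrossedProduct.unitary_mem (γ : Z ≃ₜ Z) :
    CrossedProduct.unitary γ ∈ _root_.unitary (CrossedProduct γ) := by
  constructor
  · exact Subtype.ext (Subtype.ext (funext fun ρ => (Unitary.mem_iff.1 ρ.unitary_U).1))
  · exact Subtype.ext (Subtype.ext (funext fun ρ => (Unitary.mem_iff.1 ρ.unitary_U).2))

end CrossedProduct

/-! ### Return times and towers -/

section Towers

variable {X : Type u} [TopologicalSpace X]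

/-- Under a minimal homeomorphism of a compact space, every point enters a given nonempty open
set after a bounded number of steps. -/
theorem IsMinimalHomeo.exists_bound_pow_mem [CompactSpace X] {α : X ≃ₜ X}
    (hα : IsMinimalHomeo α) {Y : Set X} (hY : IsOpen Y) (hne : Y.Nonempty) :
    ∃ N : ℕ, ∀ x, ∃ k ≤ N, (α ^ k) x ∈ Y := by
  have hdir : Monotone fun N : ℕ => ⋃ k ≤ N, (α ^ k) ⁻¹' Y := fun N M h =>
    Set.biUnion_subset_biUnion_left fun k hk => le_trans hk h
  suffices hcov : (Set.univ : Set X) ⊆ ⋃ N : ℕ, ⋃ k ≤ N, (α ^ k) ⁻¹' Y by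
    obtain ⟨N, hN⟩ := isCompact_univ.elim_directed_cover _
      (fun N => isOpen_biUnion fun k _ => hY.preimage (α ^ k).continuous) hcov hdir.directed_le
    exact ⟨N, fun x => by
      obtain ⟨k, hk, hx⟩ := Set.mem_iUnion₂.1 (hN (Set.mem_univ x))
      exact ⟨k, hk, hx⟩⟩
  -- The points that never enter `Y` form a closed set that is only forward invariant. The images `G
  -- j` of `F` under `α ^ j` decrease, and their intersection is fully invariant. Minimality makes
  -- it empty, as it misses `Y`; compactness then makes `F` itself empty.
  let F : Set X := {x | ∀ k : ℕ, (α ^ k) x ∉ Y}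
  have hFc : IsClosed F := by
    simp only [F, Set.ofPred_forall]
    exact isClosed_iInter fun k => (hY.preimage (α ^ k).continuous).isClosed_compl
  have hFα : ∀ x ∈ F, α x ∈ F := fun x hx k => by
    rw [← Homeomorph.mul_apply, ← pow_succ]; exact hx (k + 1)
  let G : ℕ → Set X := fun j => {x | ((α ^ j)⁻¹) x ∈ F}
  have hG0 : G 0 = F := rfl
  have hGc : ∀ j, IsClosed (G j) := fun j => hFc.preimage ((α ^ j)⁻¹ : X ≃ₜ X).continuous
  have hGs : ∀ j x, α x ∈ G (j + 1) ↔ x ∈ G j := fun j x => by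
    simp only [G, Set.mem_ofPred_eq, pow_succ', mul_inv_rev, Homeomorph.mul_apply]
    rw [show (α⁻¹ : X ≃ₜ X) (α x) = x from α.symm_apply_apply x]
  have hGa : ∀ j, G (j + 1) ⊆ G j := fun j x hx => by
    have := hFα _ hx
    simpa only [G, Set.mem_ofPred_eq, pow_succ, mul_inv_rev, Homeomorph.mul_apply,
      show ∀ z, α ((α⁻¹ : X ≃ₜ X) z) = z from α.apply_symm_apply] using this
  have hI : (⋂ j, G j) = ∅ := by
    rcases hα (⋂ j, G j) (isClosed_iInter hGc) (by
      ext x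
      simp only [Set.mem_image, Set.mem_iInter]
      constructor
      · rintro ⟨z, hz, rfl⟩ j
        exact hGa j ((hGs j z).2 (hz j))
      · intro hx
        refine ⟨α.symm x, fun j => ?_, α.apply_symm_apply x⟩
        rw [← hGs, α.apply_symm_apply]
        exact hx (j + 1)) with h | h
    · exact h
    · obtain ⟨z, hz⟩ := hne
      have h0 : z ∈ G 0 := Set.mem_iInter.1 (h.ge (Set.mem_univ z)) 0
      rw [hG0] at h0
      exact absurd hz (h0 0)
  have hFe : F = ∅ := by
    rw [← hG0, ← Set.not_nonempty_iff_eq_empty]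
    intro hne0
    have hanti : Antitone G := antitone_nat_of_succ_le hGa
    have hnon : ∀ j, (G j).Nonempty := fun j => by
      obtain ⟨x, hx⟩ := hne0
      rw [hG0] at hx
      exact ⟨(α ^ j) x, by simpa [G] using hx⟩
    have := IsCompact.nonempty_iInter_of_sequence_nonempty_isCompact_isClosed G hGa hnon
      (hGc 0).isCompact hGc
    rw [hI] at this
    exact Set.not_nonempty_empty this
  intro x _
  have hx : x ∉ F := by rw [hFe]; exact Set.notMem_empty x
  simp only [F, Set.mem_ofPred_eq, not_forall, not_not] at hx
  obtain ⟨k, hk⟩ := hx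
  exact Set.mem_iUnion.2 ⟨k, Set.mem_iUnion₂.2 ⟨k, le_rfl, hk⟩⟩

/-- A Kakutani-Rokhlin partition of `X` with top `Y`: finitely many towers
`U i, α (U i), …, α ^ (h i - 1) (U i)` over clopen bases that partition `X`, whose top levels
make up `Y`. -/
structure TowerPartition (α : X ≃ₜ X) (Y : Set X) where
  /-- the number of towers -/
  m : ℕ
  /-- the heights of the towers -/
  h : Fin m → ℕ
  /-- the bases of the towers -/
  U : Fin m → Set X
  h_pos : ∀ i, 0 < h i
  isClopen : ∀ i, IsClopen (U i)
  nonempty : ∀ i, (U i).Nonempty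
  exists_mem : ∀ x, ∃ i, ∃ j : Fin (h i), (α ^ (j : ℕ)).symm x ∈ U i
  unique : ∀ x i i' (j : Fin (h i)) (j' : Fin (h i')), (α ^ (j : ℕ)).symm x ∈ U i →
    (α ^ (j' : ℕ)).symm x ∈ U i' → i = i' ∧ (j : ℕ) = j'
  mem_top_iff : ∀ x i (j : Fin (h i)), (α ^ (j : ℕ)).symm x ∈ U i → (x ∈ Y ↔ (j : ℕ) + 1 = h i)

/-- Every nonempty clopen set is the top of a Kakutani-Rokhlin partition. -/
theorem IsMinimalHomeo.nonempty_towerPartition [CompactSpace X] {α : X ≃ₜ X}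
    (hα : IsMinimalHomeo α) {Y : Set X} (hY : IsClopen Y) (hne : Y.Nonempty) :
    Nonempty (TowerPartition α Y) := by
  classical
  obtain ⟨N, hN⟩ := hα.exists_bound_pow_mem hY.isOpen hne
  -- Backward entry into `Y` is needed too: it places every point above some base.
  have hαs : IsMinimalHomeo α.symm := fun F hF h =>
    hα F hF (by conv_lhs => rw [← h, ← Set.image_comp]
                simp)
  obtain ⟨_, hM⟩ := hαs.exists_bound_pow_mem hY.isOpen hne
  have hret : ∀ x, ∃ k, (α ^ k) x ∈ Y := fun x => (hN x).imp fun k hk => hk.2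
  /- The base of height `k` consists of the points of `α(Y)` that enter `Y` after exactly
  `k - 1` steps. -/
  let V : ℕ → Set X := fun k => {z | α.symm z ∈ Y ∧ 0 < k ∧ (α ^ (k - 1)) z ∈ Y ∧
    ∀ l, l + 1 < k → (α ^ l) z ∉ Y}
  have hVc : ∀ k, IsClopen (V k) := by
    intro k
    have hfin : {l : ℕ | l + 1 < k}.Finite := (Set.finite_lt_nat k).subset fun l hl => by
      have : l + 1 < k := hl
      exact show l < k by omega
    have hVk : V k = α.symm ⁻¹' Y ∩ ({_z | 0 < k} ∩ ((α ^ (k - 1)) ⁻¹' Y ∩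
        ⋂ l ∈ {l : ℕ | l + 1 < k}, ((α ^ l) ⁻¹' Y)ᶜ)) := by
      ext z
      simp [V]
    rw [hVk]
    exact (hY.preimage α.symm.continuous).inter (IsClopen.inter ⟨isClosed_const, isOpen_const⟩
      ((hY.preimage (α ^ (k - 1)).continuous).inter
        (hfin.isClopen_biInter fun l _ => (hY.preimage (α ^ l).continuous).compl)))
  have hVlt : ∀ k k' z, z ∈ V k → z ∈ V k' → k ≤ k' := fun k k' z hz hz' => by
    by_contra hlt
    have := hz'.2.1
    exact hz.2.2.2 (k' - 1) (by omega) hz'.2.2.1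
  -- A point of `V k` first enters `Y` after `k - 1 ≤ N` steps, so heights are at most `N + 1`.
  -- Empty bases are dropped.
  let H : Finset ℕ := (Finset.range (N + 2)).filter fun k => (V k).Nonempty
  let h : Fin H.card → ℕ := fun i => (H.equivFin.symm i : ℕ)
  have hhV : ∀ k, (V k).Nonempty → ∃ i, h i = k := by
    intro k hk
    have hkH : k ∈ H := by
      refine Finset.mem_filter.2 ⟨Finset.mem_range.2 ?_, hk⟩
      obtain ⟨z, hz⟩ := hk
      obtain ⟨l, hl, hlz⟩ := hN z
      by_contra hlt
      exact hz.2.2.2 l (by omega) hlz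
    exact ⟨H.equivFin ⟨k, hkH⟩, by simp [h]⟩
  have hinj : Function.Injective h := Subtype.val_injective.comp H.equivFin.symm.injective
  have hV : ∀ i, (V (h i)).Nonempty := fun i => (Finset.mem_filter.1 (H.equivFin.symm i).2).2
  have hshift : ∀ x (j l : ℕ), l < j → α.symm ((α ^ (j - l - 1)).symm x) =
      (α ^ l) ((α ^ j).symm x) := by
    intro x j l hl
    obtain ⟨d, rfl⟩ := Nat.exists_eq_add_of_lt hl
    have hx : x = (α ^ (l + d + 1)) ((α ^ (l + d + 1)).symm x) := by simp
    generalize (α ^ (l + d + 1)).symm x = z at hx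
    rw [hx, show l + d + 1 - l - 1 = d by omega, Homeomorph.symm_apply_eq,
      Homeomorph.symm_apply_eq, ← Homeomorph.mul_apply, ← Homeomorph.mul_apply, ← pow_succ,
      ← pow_add]
    congr 2
    omega
  -- If `j < j'`, the orbit segment from the base point `α ^ (-j') x` passes through `α ^ (-j - 1) x
  -- ∈ Y`, hence enters `Y` below its top.
  have hno : ∀ x i i' (j : Fin (h i)) (j' : Fin (h i')), (α ^ (j : ℕ)).symm x ∈ V (h i) →
      (α ^ (j' : ℕ)).symm x ∈ V (h i') → ¬ (j : ℕ) < j' := by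
    intro x i i' j j' hj hj' hlt
    refine hj'.2.2.2 (j' - j - 1) (by omega) ?_
    rw [← hshift x j' _ (by omega), show (j' : ℕ) - (j' - j - 1) - 1 = j by omega]
    exact hj.1
  refine ⟨⟨H.card, h, fun i => V (h i), fun i => ?_, fun i => hVc _, hV, ?_, ?_, ?_⟩⟩
  · obtain ⟨z, hz⟩ := hV i
    exact hz.2.1
  · intro x
    have hb : ∃ j : ℕ, α.symm ((α ^ j).symm x) ∈ Y := by
      obtain ⟨j, -, hj⟩ := hM (α.symm x)
      refine ⟨j, ?_⟩
      have : α.symm ((α ^ j).symm x) = (α.symm ^ j) (α.symm x) := by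
        change (α⁻¹ * (α ^ j)⁻¹) x = (α⁻¹ ^ j * α⁻¹) x
        rw [inv_pow, ← mul_inv_rev, ← mul_inv_rev, ← pow_succ, ← pow_succ']
      rwa [this]
    -- `z` is the point reached right after the last visit to `Y` strictly before `x`, and `k` is
    -- its first entry time.
    let j := Nat.find hb
    let z := (α ^ j).symm x
    let k := Nat.find (hret z)
    have hz : z ∈ V (k + 1) := ⟨Nat.find_spec hb, k.succ_pos, Nat.find_spec (hret z),
      fun l hl => Nat.find_min (hret z) (by omega)⟩
    obtain ⟨i, hi⟩ := hhV (k + 1) ⟨z, hz⟩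
    have hjk : j < h i := by
      rw [hi, Nat.lt_succ_iff]
      by_contra hlt
      -- If `k < j`, the entry of `z` at time `k` would be a later visit to `Y` before `x`.
      refine Nat.find_min hb (m := j - k - 1) (by omega) ?_
      rw [hshift x j k (by omega)]
      exact Nat.find_spec (hret z)
    exact ⟨i, ⟨j, hjk⟩, show z ∈ V (h i) by rw [hi]; exact hz⟩
  · intro x i i' j j' hj hj'
    have hjj : (j : ℕ) = j' :=
      le_antisymm (not_lt.1 (hno x i' i j' j hj' hj)) (not_lt.1 (hno x i i' j j' hj hj'))
    rw [← hjj] at hj'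
    exact ⟨hinj (le_antisymm (hVlt _ _ _ hj hj') (hVlt _ _ _ hj' hj)), hjj⟩
  · intro x i j hj
    have hx : x = (α ^ (j : ℕ)) ((α ^ (j : ℕ)).symm x) := by simp
    constructor
    · intro hxY
      by_contra hlt
      rw [hx] at hxY
      exact hj.2.2.2 j (by omega) hxY
    · intro hj1
      have hY := hj.2.2.1
      rwa [show h i - 1 = j by omega, ← hx] at hY

end Towers

/-! ### Covering dimension of products with zero-dimensional spaces -/

/-- In each coordinate only `⌈t i⌉ - 2` and `⌈t i⌉ - 1` can occur. This bounds the order of the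
cover of `ℝ^N` by open cubes of side 2 with integer corners. -/
theorem encard_int_cubes_le {N : ℕ} (t : Fin N → ℝ) :
    {k : Fin N → ℤ | ∀ i, (k i : ℝ) < t i ∧ t i < k i + 2}.encard ≤ (2 ^ N : ℕ) := by
  have hsub : {k : Fin N → ℤ | ∀ i, (k i : ℝ) < t i ∧ t i < k i + 2} ⊆
      (Fintype.piFinset fun i => Finset.Icc (⌈t i⌉ - 2) (⌈t i⌉ - 1) : Finset (Fin N → ℤ)) := by
    intro k hk
    simp only [Finset.mem_coe, Fintype.mem_piFinset, Finset.mem_Icc]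
    intro i
    obtain ⟨h1, h2⟩ := hk i
    have h3 : k i < ⌈t i⌉ := Int.lt_ceil.2 h1
    have h4 : ⌈t i⌉ ≤ k i + 2 := Int.ceil_le.2 (by push_cast; exact h2.le)
    omega
  refine (Set.encard_le_encard hsub).trans ?_
  rw [Set.encard_coe_eq_coe_finsetCard, Fintype.card_piFinset]
  simp only [Int.card_Icc]
  refine Nat.cast_le.2 (le_of_eq ?_)
  rw [Finset.prod_congr rfl (g := fun _ => 2)]
  · simp
  · intro i _; omega

/-- The product of a compact zero-dimensional space with a compact space that admits a
continuous antilipschitz map to `ℝ^N` has covering dimension at most `2 ^ N`. -/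
theorem coveringDimLE_prod_of_antilipschitz {W : Type u} [TopologicalSpace W] [CompactSpace W]
    [TopologicalSpace.MetrizableSpace W] [TotallyDisconnectedSpace W]
    {S : Type v} [MetricSpace S] [CompactSpace S]
    {N : ℕ} (e : S → Fin N → ℝ) (he : Continuous e) {K : NNReal} (hK : AntilipschitzWith K e) :
    CoveringDimLE (W × S) (2 ^ N) := by
  intro C _ hCo hCu
  let _ := TopologicalSpace.metrizableSpaceMetric W
  obtain ⟨δ, hδ, hC⟩ := lebesgue_number_lemma_of_metric_sUnion (s := (Set.univ : Set (W × S)))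
    isCompact_univ hCo hCu.ge
  -- The fibres of `g` partition `W` into finitely many clopen pieces whose points are less than `δ`
  -- apart.
  obtain ⟨r, g, b, hg, hgb⟩ := (ContinuousMap.id W).exists_finite_approximation_of_mem_nhds_diagonal
    (S := {p : W × W | dist p.1 p.2 < δ / 2})
    ((isOpen_lt (by fun_prop) (by fun_prop)).mem_nhdsSet.2 (by
      rintro ⟨x, y⟩ (rfl : x = y); simpa using hδ))
  have hW : ∀ x y : W, g x = g y → dist x y < δ := by
    intro x y hxy
    have h1 : dist x (b (g x)) < δ / 2 := hgb x
    have h2 : dist y (b (g y)) < δ / 2 := hgb y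
    rw [← hxy] at h2
    linarith [dist_triangle_right x y (b (g x))]
  -- Cubes of side `2 * ε` pull back under `e` to sets of diameter below the Lebesgue number `δ`.
  obtain ⟨ε, hε, hεδ⟩ : ∃ ε : ℝ, 0 < ε ∧ K * (2 * ε) < δ := by
    refine ⟨δ / (2 * (K + 1)), by positivity, ?_⟩
    have : (0 : ℝ) ≤ K := K.2
    rw [show (K : ℝ) * (2 * (δ / (2 * (K + 1)))) = δ * (K / (K + 1)) by field_simp]
    exact mul_lt_of_lt_one_right hδ ((div_lt_one (by positivity)).2 (by linarith))
  let Q : Fin r × (Fin N → ℤ) → Set (W × S) := fun q =>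
    {p | g p.1 = q.1 ∧ ∀ i, (q.2 i : ℝ) < e p.2 i / ε ∧ e p.2 i / ε < q.2 i + 2}
  have hQo : ∀ q, IsOpen (Q q) := by
    intro q
    refine IsOpen.inter ?_ ?_
    · exact (isOpen_discrete {q.1}).preimage (hg.comp continuous_fst)
    · have hcube : IsOpen (⋂ i, {p : W × S | (q.2 i : ℝ) < e p.2 i / ε} ∩
          {p | e p.2 i / ε < q.2 i + 2}) :=
        isOpen_iInter_of_finite fun i =>
          (isOpen_lt (by fun_prop) (by fun_prop)).inter (isOpen_lt (by fun_prop) (by fun_prop))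
      have heq : {p : W × S | ∀ i, (q.2 i : ℝ) < e p.2 i / ε ∧ e p.2 i / ε < q.2 i + 2} =
          ⋂ i, {p : W × S | (q.2 i : ℝ) < e p.2 i / ε} ∩ {p | e p.2 i / ε < q.2 i + 2} := by
        ext p; simp
      exact (congrArg IsOpen heq).mpr hcube
  have hQd : ∀ q, ∀ p ∈ Q q, ∀ p' ∈ Q q, dist p p' < δ := by
    rintro q p ⟨h1, h2⟩ p' ⟨h1', h2'⟩
    rw [Prod.dist_eq, max_lt_iff]
    refine ⟨hW _ _ (h1.trans h1'.symm), (hK.le_mul_dist _ _).trans_lt (lt_of_le_of_lt ?_ hεδ)⟩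
    refine mul_le_mul_of_nonneg_left ((dist_pi_le_iff (by positivity)).2 fun i => ?_) K.2
    obtain ⟨a1, a2⟩ := h2 i
    obtain ⟨b1, b2⟩ := h2' i
    rw [lt_div_iff₀ hε] at a1 b1
    rw [div_lt_iff₀ hε] at a2 b2
    rw [Real.dist_eq, abs_le]
    constructor <;> nlinarith
  have hQc : ∀ p, ∃ q, p ∈ Q q := fun p =>
    ⟨(g p.1, fun i => ⌈e p.2 i / ε⌉ - 1), rfl, fun i => by
      have h1 := Int.ceil_lt_add_one (e p.2 i / ε)
      have h2 := Int.le_ceil (e p.2 i / ε)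
      push_cast
      constructor <;> linarith⟩
  obtain ⟨T, hT⟩ := isCompact_univ.elim_finite_subcover Q hQo
    (fun p _ => Set.mem_iUnion.2 (hQc p))
  have hQe : ∀ p, {q | p ∈ Q q}.encard ≤ (2 ^ N : ℕ) := by
    intro p
    refine le_trans ?_ (encard_int_cubes_le fun i => e p.2 i / ε)
    -- The pieces of `W` are disjoint, so only the cubes contribute to the order.
    refine Set.encard_le_encard_of_injOn (f := Prod.snd) (fun q hq => hq.2) ?_
    rintro q ⟨hq, _⟩ q' ⟨hq', _⟩ h
    exact Prod.ext (hq.symm.trans hq') h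
  -- Nonemptiness supplies a point whose `δ`-ball selects the member of `C` containing `Q q`.
  refine ⟨Q '' {q | q ∈ T ∧ (Q q).Nonempty}, ?_, ?_, ?_, ?_, ?_⟩
  · exact (T.finite_toSet.subset fun q hq => hq.1).image Q
  · rintro _ ⟨q, _, rfl⟩; exact hQo q
  · refine Set.eq_univ_of_forall fun p => ?_
    obtain ⟨q, hq, hp⟩ := Set.mem_iUnion₂.1 (hT (Set.mem_univ p))
    exact ⟨Q q, ⟨q, ⟨hq, p, hp⟩, rfl⟩, hp⟩
  · rintro _ ⟨q, ⟨_, p, hp⟩, rfl⟩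
    obtain ⟨U, hU, hpU⟩ := hC p (Set.mem_univ p)
    exact ⟨U, hU, fun p' hp' => hpU (Metric.mem_ball.2 (hQd q p' hp' p hp))⟩
  · intro p
    have hsub : {V ∈ Q '' {q | q ∈ T ∧ (Q q).Nonempty} | p ∈ V} ⊆ Q '' {q | p ∈ Q q} := by
      rintro _ ⟨⟨q, _, rfl⟩, hp⟩
      exact ⟨q, hp, rfl⟩
    calc _ ≤ (Q '' {q | p ∈ Q q}).encard := Set.encard_le_encard hsub
      _ ≤ {q | p ∈ Q q}.encard := Set.encard_image_le _ _
      _ ≤ (2 ^ N : ℕ) := hQe p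
      _ ≤ _ := Nat.cast_le.2 (Nat.le_succ _)

/-- The coordinates of `ℝ^(n+1)`, with the sup norm, provide the antilipschitz map. The bound is
crude; what matters is that it does not depend on `W`. -/
theorem coveringDimLE_prod_unitSphere {W : Type u} [TopologicalSpace W] [CompactSpace W]
    [TopologicalSpace.MetrizableSpace W] [TotallyDisconnectedSpace W] (n : ℕ) :
    CoveringDimLE (W × UnitSphere n) (2 ^ (n + 1)) :=
  coveringDimLE_prod_of_antilipschitz (fun s i => s.1 i) (by fun_prop)
    ((PiLp.antilipschitzWith_ofLp 2 _).comp (AntilipschitzWith.subtype_coe _))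

/-! ### Covariant pairs -/

/-- A unital `*`-homomorphism of `C(Z)` into a unital `*`-algebra together with a unitary that
implements `γ`. -/
structure CovariantPair {Z : Type u} [TopologicalSpace Z] (γ : Z ≃ₜ Z) (A : Type v) [Ring A]
    [StarRing A] [Algebra ℂ A] where
  /-- the homomorphism on functions -/
  toHom : C(Z, ℂ) →⋆ₐ[ℂ] A
  /-- the implementing unitary -/
  u : A
  star_mul_self : star u * u = 1
  mul_star_self : u * star u = 1
  covariant : ∀ f : C(Z, ℂ), u * toHom f * star u = toHom (f.comp (γ.symm : C(Z, Z)))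

/-- The covariant pair that generates the crossed product. -/
noncomputable def CrossedProduct.covariantPair {Z : Type u} [TopologicalSpace Z] [CompactSpace Z]
    (γ : Z ≃ₜ Z) : CovariantPair γ (CrossedProduct γ) where
  toHom := CrossedProduct.ofFunHom γ
  u := CrossedProduct.unitary γ
  star_mul_self := (CrossedProduct.unitary_mem γ).1
  mul_star_self := (CrossedProduct.unitary_mem γ).2
  covariant := CrossedProduct.covariance γ

namespace CovariantPair

variable {Z : Type u} [TopologicalSpace Z] {γ : Z ≃ₜ Z} {A : Type v} [Ring A] [StarRing A]
  [Algebra ℂ A] (P : CovariantPair γ A)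

theorem star_pow_mul_pow (j : ℕ) : star (P.u ^ j) * P.u ^ j = 1 := by
  rw [star_pow]
  exact ((show Commute (star P.u) P.u by
    rw [commute_iff_eq, P.star_mul_self, P.mul_star_self]).mul_pow j).symm.trans
      (by rw [P.star_mul_self, one_pow])

theorem covariant_pow (j : ℕ) (f : C(Z, ℂ)) :
    P.u ^ j * P.toHom f * star (P.u ^ j) = P.toHom (f.comp ((γ ^ j).symm : C(Z, Z))) := by
  induction j generalizing f with
  | zero => simp; rfl
  | succ j ih =>
    rw [pow_succ, star_mul, show P.u ^ j * P.u * P.toHom f * (star P.u * star (P.u ^ j)) =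
      P.u ^ j * (P.u * P.toHom f * star P.u) * star (P.u ^ j) by simp only [mul_assoc],
      P.covariant, ih]
    rfl

theorem pow_mul_toHom (j : ℕ) (f : C(Z, ℂ)) :
    P.u ^ j * P.toHom f = P.toHom (f.comp ((γ ^ j).symm : C(Z, Z))) * P.u ^ j := by
  rw [← P.covariant_pow, mul_assoc, P.star_pow_mul_pow, mul_one]

/-- Left multiplication by `u ^ j` is injective and produces the product of the two translates. This
is the orthogonality of functions moved to disjoint levels. -/
theorem toHom_mul_pow_mul_toHom_eq_zero (j k : ℕ) (f g : C(Z, ℂ))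
    (h : ∀ z, f ((γ ^ j).symm z) * g ((γ ^ k).symm z) = 0) :
    P.toHom f * star (P.u ^ j) * (P.u ^ k * P.toHom g) = 0 := by
  have h0 : f.comp ((γ ^ j).symm : C(Z, Z)) * g.comp ((γ ^ k).symm : C(Z, Z)) = 0 :=
    ContinuousMap.ext h
  have h1 : P.u ^ j * (P.toHom f * star (P.u ^ j) * (P.u ^ k * P.toHom g)) = 0 := by
    rw [P.pow_mul_toHom k, ← mul_assoc, ← mul_assoc, ← mul_assoc, P.covariant_pow, ← map_mul, h0,
      map_zero, zero_mul]
  calc _ = star (P.u ^ j) * P.u ^ j *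
        (P.toHom f * star (P.u ^ j) * (P.u ^ k * P.toHom g)) := by
        rw [P.star_pow_mul_pow, one_mul]
    _ = 0 := by rw [mul_assoc, h1, mul_zero]

end CovariantPair

/-! ### Extension by zero -/

section Extension

variable {X : Type u} [TopologicalSpace X] {S : Type v} [TopologicalSpace S]

open Classical in
/-- Extension by zero of functions on `U × S` to functions on `X × S`, for clopen `U`. -/
noncomputable def extendByZero {U : Set X} (hU : IsClopen U) : C(U × S, ℂ) →⋆ₙₐ[ℂ] C(X × S, ℂ) where
  toFun f :=
    { toFun := fun z => if hz : z.1 ∈ U then f (⟨z.1, hz⟩, z.2) else 0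
      continuous_toFun := continuous_iff_continuousAt.2 fun z => by
        by_cases hz : z.1 ∈ U
        · have he : Topology.IsOpenEmbedding (Prod.map ((↑) : U → X) (id : S → S)) :=
            hU.isOpen.isOpenEmbedding_subtypeVal.prodMap .id
          refine (he.continuousAt_iff (x := (⟨z.1, hz⟩, z.2))).1 ?_
          convert f.continuous.continuousAt using 1
          ext w
          simp
        · refine (continuousAt_const (y := (0 : ℂ))).congr ?_
          filter_upwards [(hU.compl.isOpen.preimage continuous_fst).mem_nhds hz] with w hw
          have hw' : w.1 ∉ U := hw
          simp [hw'] }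
  map_smul' c f := by ext z; by_cases hz : z.1 ∈ U <;> simp [hz]
  map_zero' := by ext z; simp
  map_add' f g := by ext z; by_cases hz : z.1 ∈ U <;> simp [hz]
  map_mul' f g := by ext z; by_cases hz : z.1 ∈ U <;> simp [hz]
  map_star' f := by ext z; by_cases hz : z.1 ∈ U <;> simp [hz]

theorem extendByZero_of_mem {U : Set X} (hU : IsClopen U) (f : C(U × S, ℂ)) {z : X × S}
    (hz : z.1 ∈ U) : extendByZero hU f z = f (⟨z.1, hz⟩, z.2) := dif_pos hz

theorem extendByZero_of_notMem {U : Set X} (hU : IsClopen U) (f : C(U × S, ℂ)) {z : X × S}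
    (hz : z.1 ∉ U) : extendByZero hU f z = 0 := dif_neg hz

theorem extendByZero_injective {U : Set X} (hU : IsClopen U) :
    Function.Injective (extendByZero (S := S) hU) := fun f g h => by
  ext ⟨x, s⟩
  have := DFunLike.congr_fun h (x.1, s)
  rwa [extendByZero_of_mem hU f x.2, extendByZero_of_mem hU g x.2] at this

/-- Restriction of functions on `X × S` to `U × S`. -/
noncomputable def restrictFst (U : Set X) (f : C(X × S, ℂ)) : C(U × S, ℂ) :=
  f.comp ⟨fun p => (p.1, p.2), by fun_prop⟩

theorem prodCongr_pow_symm_fst (α : X ≃ₜ X) (β : S ≃ₜ S) (j : ℕ) (z : X × S) :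
    (((α.prodCongr β) ^ j).symm z).1 = (α ^ j).symm z.1 := by
  induction j generalizing z with
  | zero => rfl
  | succ j ih =>
    change (((α.prodCongr β) ^ (j + 1))⁻¹ z).1 = (α ^ (j + 1))⁻¹ z.1
    rw [pow_succ', pow_succ', mul_inv_rev, mul_inv_rev]
    exact ih _

end Extension

/-! ### The matrix algebras of a Kakutani-Rokhlin partition -/

namespace TowerPartition

variable {X : Type u} [TopologicalSpace X] {S : Type} [TopologicalSpace S] {α : X ≃ₜ X}
  {β : S ≃ₜ S} {A : Type v} [Ring A] [StarRing A] [Algebra ℂ A] {Y : Set X}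
  (P : CovariantPair (α.prodCongr β) A) (T : TowerPartition α Y)

/-- The element `u ^ j g u ^ (-k)`, for a function `g` on the base of a tower. -/
noncomputable def unit (i : Fin T.m) (j k : ℕ) (g : C(T.U i × S, ℂ)) : A :=
  P.u ^ j * P.toHom (extendByZero (T.isClopen i) g) * star (P.u ^ k)

theorem unit_zero (i : Fin T.m) (j k : ℕ) : T.unit P i j k 0 = 0 := by
  simp [unit]

theorem unit_add (i : Fin T.m) (j k : ℕ) (g g' : C(T.U i × S, ℂ)) :
    T.unit P i j k (g + g') = T.unit P i j k g + T.unit P i j k g' := by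
  simp [unit, mul_add, add_mul]

theorem unit_smul (i : Fin T.m) (j k : ℕ) (c : ℂ) (g : C(T.U i × S, ℂ)) :
    T.unit P i j k (c • g) = c • T.unit P i j k g := by
  simp [unit, map_smul]

theorem unit_sum (i : Fin T.m) (j k : ℕ) {κ : Type*} (s : Finset κ) (g : κ → C(T.U i × S, ℂ)) :
    T.unit P i j k (∑ l ∈ s, g l) = ∑ l ∈ s, T.unit P i j k (g l) := by
  simp [unit, map_sum, Finset.mul_sum, Finset.sum_mul]

theorem star_unit (i : Fin T.m) (j k : ℕ) (g : C(T.U i × S, ℂ)) :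
    star (T.unit P i j k g) = T.unit P i k j (star g) := by
  rw [unit, unit, star_mul, star_mul, star_star, ← map_star, ← map_star, mul_assoc]

theorem unit_mul_unit (i : Fin T.m) (j k l : ℕ) (g g' : C(T.U i × S, ℂ)) :
    T.unit P i j k g * T.unit P i k l g' = T.unit P i j l (g * g') := by
  calc T.unit P i j k g * T.unit P i k l g' = P.u ^ j * P.toHom (extendByZero (T.isClopen i) g) *
        (star (P.u ^ k) * P.u ^ k) * P.toHom (extendByZero (T.isClopen i) g') * star (P.u ^ l) := by
        simp only [unit, mul_assoc]
    _ = T.unit P i j l (g * g') := by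
      rw [P.star_pow_mul_pow, mul_one, unit, map_mul, map_mul]
      simp only [mul_assoc]

/-- Distinct levels of the towers are disjoint. -/
theorem unit_mul_unit_of_ne {i i' : Fin T.m} (j l : ℕ) (k : Fin (T.h i)) (k' : Fin (T.h i'))
    (hne : ¬ (i = i' ∧ (k : ℕ) = k')) (g : C(T.U i × S, ℂ)) (g' : C(T.U i' × S, ℂ)) :
    T.unit P i j k g * T.unit P i' k' l g' = 0 := by
  have h0 := P.toHom_mul_pow_mul_toHom_eq_zero k k' (extendByZero (T.isClopen i) g)
    (extendByZero (T.isClopen i') g') fun z => by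
      by_cases h1 : (α ^ (k : ℕ)).symm z.1 ∈ T.U i
      · by_cases h2 : (α ^ (k' : ℕ)).symm z.1 ∈ T.U i'
        · exact absurd (T.unique _ _ _ _ _ h1 h2) hne
        · rw [extendByZero_of_notMem (z := ((α.prodCongr β) ^ (k' : ℕ)).symm z) _ _
            (by rwa [prodCongr_pow_symm_fst]), mul_zero]
      · rw [extendByZero_of_notMem _ _ (by rwa [prodCongr_pow_symm_fst]), zero_mul]
  calc T.unit P i j k g * T.unit P i' k' l g' = P.u ^ j *
        (P.toHom (extendByZero (T.isClopen i) g) * star (P.u ^ (k : ℕ)) *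
          (P.u ^ (k' : ℕ) * P.toHom (extendByZero (T.isClopen i') g'))) * star (P.u ^ l) := by
        simp only [unit, mul_assoc]
    _ = 0 := by rw [h0, mul_zero, zero_mul]

/-- The part of a function over the `j`-th level of a tower, moved to the base. -/
noncomputable def levelPart (β : S ≃ₜ S) (i : Fin T.m) (j : ℕ) (f : C(X × S, ℂ)) :
    C(T.U i × S, ℂ) :=
  restrictFst (T.U i) (f.comp ((α.prodCongr β) ^ j : (X × S) ≃ₜ (X × S)))

theorem extend_levelPart_of_mem {i : Fin T.m} {j : ℕ} (f : C(X × S, ℂ)) {z : X × S}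
    (hz : (α ^ j).symm z.1 ∈ T.U i) :
    extendByZero (T.isClopen i) (T.levelPart β i j f) (((α.prodCongr β) ^ j).symm z) = f z := by
  rw [extendByZero_of_mem _ _ (by rwa [prodCongr_pow_symm_fst])]
  exact congrArg f (((α.prodCongr β) ^ j).apply_symm_apply z)

theorem levelPart_one (i : Fin T.m) (j : ℕ) : T.levelPart β i j 1 = 1 := rfl

/-- A function is the sum of its parts over the levels of the towers. -/
theorem sum_unit_levelPart (f : C(X × S, ℂ)) :
    ∑ i, ∑ j : Fin (T.h i), T.unit P i j j (T.levelPart β i j f) = P.toHom f := by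
  simp only [unit, P.covariant_pow, ← map_sum]
  congr 1
  ext z
  simp only [ContinuousMap.sum_apply]
  obtain ⟨i, j, hij⟩ := T.exists_mem z.1
  rw [Finset.sum_eq_single i, Finset.sum_eq_single j]
  · exact T.extend_levelPart_of_mem f hij
  · intro j' _ hne
    refine extendByZero_of_notMem (T.isClopen i) _ fun hj' => hne ?_
    rw [ContinuousMap.coe_coe, prodCongr_pow_symm_fst] at hj'
    exact Fin.ext (T.unique _ _ _ _ _ hj' hij).2
  · simp
  · intro i' _ hne
    refine Finset.sum_eq_zero fun j' _ =>
      extendByZero_of_notMem (T.isClopen i') _ fun hj' => hne ?_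
    rw [ContinuousMap.coe_coe, prodCongr_pow_symm_fst] at hj'
    exact (T.unique _ _ _ _ _ hj' hij).1
  · simp

/-- The `*`-homomorphism that represents `⊕ᵢ M_{h i}(C(U i × S))` by the partial isometries of the
towers. -/
noncomputable def towerHom : MatrixSum T.h (fun i => T.U i × S) →⋆ₐ[ℂ] A :=
  have hone : (∑ i, ∑ j : Fin (T.h i), ∑ k : Fin (T.h i), T.unit P i j k
      ((1 : MatrixSum T.h (fun i => T.U i × S)) i j k)) = 1 := by
    rw [← map_one P.toHom, ← T.sum_unit_levelPart P]
    refine Finset.sum_congr rfl fun i _ => Finset.sum_congr rfl fun j _ => ?_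
    rw [Finset.sum_eq_single j]
    · rw [Pi.one_apply, CStarMatrix.one_apply_eq, levelPart_one]
    · intro k _ hk
      rw [Pi.one_apply, CStarMatrix.one_apply_ne' hk, unit_zero]
    · simp
  { toFun := fun a => ∑ i, ∑ j : Fin (T.h i), ∑ k : Fin (T.h i), T.unit P i j k (a i j k)
    map_one' := hone
    map_zero' := by
      simp only [Pi.zero_apply, CStarMatrix.zero_apply, unit_zero, Finset.sum_const_zero]
    map_add' := fun a b => by
      simp only [Pi.add_apply, CStarMatrix.add_apply, unit_add, Finset.sum_add_distrib]
    map_mul' := fun a b => by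
      symm
      rw [Finset.sum_mul]
      refine Finset.sum_congr rfl fun i _ => ?_
      rw [Finset.mul_sum, Finset.sum_eq_single i]
      · rw [Finset.sum_mul]
        refine Finset.sum_congr rfl fun j _ => ?_
        simp only [Pi.mul_apply, CStarMatrix.mul_apply, unit_sum]
        rw [Finset.sum_mul]
        refine Eq.trans ?_ Finset.sum_comm
        refine Finset.sum_congr rfl fun k _ => ?_
        rw [Finset.mul_sum, Finset.sum_eq_single k]
        · rw [Finset.mul_sum]
          exact Finset.sum_congr rfl fun l _ => T.unit_mul_unit P i j k l _ _
        · intro k' _ hk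
          rw [Finset.mul_sum]
          exact Finset.sum_eq_zero fun l _ => T.unit_mul_unit_of_ne P j l k k'
            (fun h => hk (Fin.ext h.2.symm)) _ _
        · simp
      · intro i' _ hi
        simp only [Finset.sum_mul, Finset.mul_sum]
        exact Finset.sum_eq_zero fun j _ => Finset.sum_eq_zero fun k _ =>
          Finset.sum_eq_zero fun k' _ => Finset.sum_eq_zero fun l _ =>
            T.unit_mul_unit_of_ne P _ _ _ _ (fun h => hi h.1.symm) _ _
      · simp
    commutes' := fun c => by
      rw [Algebra.algebraMap_eq_smul_one, Algebra.algebraMap_eq_smul_one, ← hone]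
      simp only [Pi.smul_apply, CStarMatrix.smul_apply, unit_smul, Finset.smul_sum]
    map_star' := fun a => by
      simp only [star_sum, star_unit, Pi.star_apply, CStarMatrix.star_apply]
      exact Finset.sum_congr rfl fun i _ => Finset.sum_comm }

theorem towerHom_apply (a : MatrixSum T.h (fun i => T.U i × S)) :
    T.towerHom P a = ∑ i, ∑ j : Fin (T.h i), ∑ k : Fin (T.h i), T.unit P i j k (a i j k) := rfl

theorem towerHom_single (i : Fin T.m) (j k : Fin (T.h i))
    (g : C(T.U i × S, ℂ)) :
    T.towerHom P (Pi.single i (CStarMatrix.ofMatrix (Matrix.of fun j' k' =>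
      if j' = j ∧ k' = k then g else 0))) = T.unit P i j k g := by
  have hE : ∀ j' k', (CStarMatrix.ofMatrix (Matrix.of fun j' k' =>
      if j' = j ∧ k' = k then g else 0)) j' k' = if j' = j ∧ k' = k then g else 0 :=
    fun _ _ => rfl
  rw [towerHom_apply, Finset.sum_eq_single i, Finset.sum_eq_single j, Finset.sum_eq_single k]
  · rw [Pi.single_eq_same, hE, if_pos ⟨rfl, rfl⟩]
  · intro k' _ hk
    rw [Pi.single_eq_same, hE, if_neg fun h => hk h.2, unit_zero]
  · simp
  · intro j' _ hj
    refine Finset.sum_eq_zero fun k' _ => ?_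
    rw [Pi.single_eq_same, hE, if_neg fun h => hj h.1, unit_zero]
  · simp
  · intro i' _ hi
    refine Finset.sum_eq_zero fun j' _ => Finset.sum_eq_zero fun k' _ => ?_
    rw [Pi.single_eq_of_ne hi, CStarMatrix.zero_apply, unit_zero]
  · simp

/-- Compression by matrix units carries a single entry to the base corner, where it is a plain
function; injectivity of `towerHom` follows. -/
theorem unit_mul_towerHom_mul_unit (a : MatrixSum T.h (fun i => T.U i × S)) (i : Fin T.m)
    (j k : Fin (T.h i)) :
    T.unit P i 0 j 1 * T.towerHom P a * T.unit P i k 0 1 = T.unit P i 0 0 (a i j k) := by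
  simp only [towerHom_apply, Finset.mul_sum, Finset.sum_mul]
  rw [Finset.sum_eq_single i, Finset.sum_eq_single j, Finset.sum_eq_single k]
  · rw [unit_mul_unit, unit_mul_unit, one_mul, mul_one]
  · intro k' _ hk
    rw [mul_assoc, T.unit_mul_unit_of_ne P _ _ _ _ (fun h => hk (Fin.ext h.2)), mul_zero]
  · simp
  · intro j' _ hj
    refine Finset.sum_eq_zero fun k' _ => ?_
    rw [T.unit_mul_unit_of_ne P _ _ _ _ (fun h => hj (Fin.ext h.2.symm)), zero_mul]
  · simp
  · intro i' _ hi
    refine Finset.sum_eq_zero fun j' _ => Finset.sum_eq_zero fun k' _ => ?_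
    rw [T.unit_mul_unit_of_ne P _ _ _ _ (fun h => hi h.1.symm), zero_mul]
  · simp

theorem towerHom_injective (hP : Function.Injective P.toHom) :
    Function.Injective (T.towerHom P) := by
  refine (injective_iff_map_eq_zero _).2 fun a ha => ?_
  funext i
  refine CStarMatrix.ext fun j k => ?_
  have h := T.unit_mul_towerHom_mul_unit P a i j k
  rw [ha, mul_zero, zero_mul, unit, pow_zero, one_mul, star_one, mul_one] at h
  have h1 := hP (h.symm.trans (map_zero P.toHom).symm)
  exact extendByZero_injective (T.isClopen i) (h1.trans (map_zero _).symm)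

end TowerPartition

/-- The `*`-algebra generated by the functions on `X × S` and by the products of the unitary with
the functions that vanish on `Y × S`. -/
noncomputable def CovariantPair.breaking {X : Type u} [TopologicalSpace X] {S : Type}
    [TopologicalSpace S] {α : X ≃ₜ X} {β : S ≃ₜ S} {A : Type v} [Ring A] [StarRing A] [Algebra ℂ A]
    [StarModule ℂ A] (P : CovariantPair (α.prodCongr β) A) (Y : Set X) : StarSubalgebra ℂ A :=
  StarAlgebra.adjoin ℂ (Set.range P.toHom ∪
    {a | ∃ f : C(X × S, ℂ), (∀ x ∈ Y, ∀ s : S, f (x, s) = 0) ∧ a = P.u * P.toHom f})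

namespace TowerPartition

variable {X : Type u} [TopologicalSpace X] {S : Type} [TopologicalSpace S] {α : X ≃ₜ X}
  {β : S ≃ₜ S} {A : Type v} [Ring A] [StarRing A] [Algebra ℂ A] [StarModule ℂ A] {Y : Set X}
  (P : CovariantPair (α.prodCongr β) A) (T : TowerPartition α Y)

/-- Climb one level at a time: `u ^ (j + 1) g = (u χ) (u ^ j g)` with `χ` the indicator of level
`j`. As `j + 1 < h i`, this level is not the top, so `χ` vanishes over `Y` and `u χ` is a generator.
-/
theorem pow_mul_extend_mem_breaking (i : Fin T.m) (g : C(T.U i × S, ℂ)) (j : ℕ) (hj : j < T.h i) :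
    P.u ^ j * P.toHom (extendByZero (T.isClopen i) g) ∈ P.breaking Y := by
  induction j generalizing g with
  | zero =>
    rw [pow_zero, one_mul]
    exact StarAlgebra.subset_adjoin ℂ _ (Or.inl ⟨_, rfl⟩)
  | succ j ih =>
    have hmem : P.u * P.toHom ((extendByZero (T.isClopen i) 1).comp
        (((α.prodCongr β) ^ j).symm : C(X × S, X × S))) ∈ P.breaking Y := by
      refine StarAlgebra.subset_adjoin ℂ _ (Or.inr ⟨_, fun x hx s => ?_, rfl⟩)
      refine extendByZero_of_notMem (T.isClopen i) _ fun hz => ?_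
      rw [ContinuousMap.coe_coe, prodCongr_pow_symm_fst] at hz
      have h1 : j + 1 = T.h i := (T.mem_top_iff x i ⟨j, by omega⟩ hz).1 hx
      omega
    have := mul_mem hmem (ih g (by omega))
    rwa [mul_assoc, ← mul_assoc (P.toHom _), ← P.pow_mul_toHom, mul_assoc (P.u ^ j), ← map_mul,
      ← map_mul, one_mul, ← mul_assoc, ← pow_succ'] at this

/-- Factor `u ^ j g u ^ (-k)` as `(u ^ j g) (u ^ k 1)*`, where `1` is the indicator of the base. -/
theorem unit_mem_breaking (i : Fin T.m) (j k : Fin (T.h i)) (g : C(T.U i × S, ℂ)) :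
    T.unit P i j k g ∈ P.breaking Y := by
  have h := mul_mem (T.pow_mul_extend_mem_breaking P i g j j.2)
    (star_mem (T.pow_mul_extend_mem_breaking P i 1 k k.2))
  rwa [star_mul, ← map_star, ← map_star, star_one, mul_assoc, ← mul_assoc (P.toHom _), ← map_mul,
    ← map_mul, mul_one, ← mul_assoc] at h

/-- The matrix algebras of a Kakutani-Rokhlin partition with top `Y` generate the orbit breaking
algebra of `Y`. -/
theorem range_towerHom : StarAlgHom.range (A := MatrixSum T.h fun i => T.U i × S) (T.towerHom P) = P.breaking Y := by
  have hunit : ∀ (i : Fin T.m) (j k : Fin (T.h i)) (g : C(T.U i × S, ℂ)),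
      T.unit P i j k g ∈ StarAlgHom.range (A := MatrixSum T.h fun i => T.U i × S) (T.towerHom P) := fun i j k g => ⟨_, T.towerHom_single P i j k g⟩
  apply le_antisymm
  · rintro _ ⟨a, rfl⟩
    change T.towerHom P a ∈ P.breaking Y
    rw [towerHom_apply]
    exact sum_mem fun i _ => sum_mem fun j _ => sum_mem fun k _ => T.unit_mem_breaking P i j k _
  · refine StarAlgebra.adjoin_le (Set.union_subset ?_ ?_)
    · rintro _ ⟨f, rfl⟩
      rw [← T.sum_unit_levelPart P f]
      exact sum_mem fun i _ => sum_mem fun j _ => hunit i j j _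
    · rintro _ ⟨f, hf, rfl⟩
      rw [← T.sum_unit_levelPart P f, Finset.mul_sum]
      refine sum_mem fun i _ => ?_
      rw [Finset.mul_sum]
      refine sum_mem fun j _ => ?_
      -- Below the top, `u` turns the diagonal unit at `j` into the unit at `(j + 1, j)`; on the top
      -- level, which lies in `Y`, `f` vanishes.
      by_cases hj : (j : ℕ) + 1 < T.h i
      · have := hunit i ⟨j + 1, hj⟩ j (T.levelPart β i j f)
        rwa [unit, pow_succ', mul_assoc, mul_assoc, ← mul_assoc (P.u ^ (j : ℕ))] at this
      · have h0 : T.levelPart β i j f = 0 := by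
          ext ⟨x, s⟩
          refine hf _ ((T.mem_top_iff _ i j ?_).2 (by omega)) _
          rw [← prodCongr_pow_symm_fst α β]
          simp
        rw [h0, unit_zero, mul_zero]
        exact zero_mem _

end TowerPartition

/-! ### Orbit breaking at a point -/

section OrbitBreaking

variable {X : Type u} [TopologicalSpace X] {S : Type} [TopologicalSpace S]

theorem CovariantPair.breaking_antitone {α : X ≃ₜ X} {β : S ≃ₜ S} {A : Type v} [Ring A] [StarRing A]
    [Algebra ℂ A] [StarModule ℂ A] (P : CovariantPair (α.prodCongr β) A) :
    Antitone P.breaking := fun _ _ h =>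
  StarAlgebra.adjoin_mono (Set.union_subset_union_right _
    fun _ ⟨f, hf, ha⟩ => ⟨f, fun x hx => hf x (h hx), ha⟩)

theorem CovariantPair.coe_iSup_breaking {α : X ≃ₜ X} {β : S ≃ₜ S} {A : Type v} [Ring A]
    [StarRing A] [Algebra ℂ A] [StarModule ℂ A] (P : CovariantPair (α.prodCongr β) A)
    {Y : ℕ → Set X} (hY : Antitone Y) :
    ((⨆ k, P.breaking (Y k) : StarSubalgebra ℂ A) : Set A) = ⋃ k, (P.breaking (Y k) : Set A) :=
  StarSubalgebra.coe_iSup_of_directed (P.breaking_antitone.comp hY).directed_le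

theorem TowerPartition.nonempty_starAlgEquiv {α : X ≃ₜ X} {β : S ≃ₜ S} {A : Type v}
    [CStarAlgebra A] (P : CovariantPair (α.prodCongr β) A) (hP : Function.Injective P.toHom)
    {Y : Set X} (T : TowerPartition α Y) (D : StarSubalgebra ℂ A) (hle : P.breaking Y ≤ D) :
    Nonempty ((P.breaking Y).comap D.subtype ≃⋆ₐ[ℂ] MatrixSum T.h (fun i => T.U i × S)) := by
  have hmem : ∀ a, T.towerHom P a ∈ D := fun a => hle ((T.range_towerHom P).le ⟨a, rfl⟩)
  let Φ := StarAlgHom.codRestrict (A := MatrixSum T.h (fun i => T.U i × S)) (T.towerHom P) _ hmem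
  have hinj : Function.Injective Φ := fun a b hab =>
    T.towerHom_injective P hP (congrArg Subtype.val hab)
  have hrange : StarAlgHom.range (A := MatrixSum T.h (fun i => T.U i × S)) Φ =
      (P.breaking Y).comap D.subtype := by
    rw [← T.range_towerHom P]
    exact StarSubalgebra.ext fun x =>
      ⟨fun ⟨a, ha⟩ => ⟨a, congrArg Subtype.val ha⟩, fun ⟨a, ha⟩ => ⟨a, Subtype.ext ha⟩⟩
  rw [← hrange]
  exact ⟨(StarAlgEquiv.ofInjective (A := MatrixSum T.h (fun i => T.U i × S)) Φ hinj).symm⟩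

variable [CompactSpace X] [CompactSpace S]

/-- A function that vanishes over `y` is uniformly close to one that vanishes over a clopen
neighbourhood of `y`. -/
theorem exists_norm_sub_le_of_hasAntitoneBasis {y : X} {Y : ℕ → Set X} (hYc : ∀ k, IsClopen (Y k))
    (hYb : (nhds y).HasAntitoneBasis Y) (f : C(X × S, ℂ)) (hf : ∀ s, f (y, s) = 0) {ε : ℝ}
    (hε : 0 < ε) : ∃ (k : ℕ) (g : C(X × S, ℂ)), (∀ x ∈ Y k, ∀ s, g (x, s) = 0) ∧ ‖f - g‖ ≤ ε := by
  -- Compactness of `S` gives one neighbourhood `V` of `y` with `‖f‖ < ε` on all of `V × S`; cutting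
  -- `f` off over a clopen `Y k ⊆ V` then costs at most `ε`.
  obtain ⟨V, W, hV, -, hyV, hSW, hVW⟩ := generalized_tube_lemma (isCompact_singleton (x := y))
    (isCompact_univ (X := S)) (n := {z : X × S | ‖f z‖ < ε})
    (isOpen_lt (by fun_prop) (by fun_prop)) (by
      rintro ⟨x, s⟩ ⟨rfl : x = y, -⟩
      simpa [hf] using hε)
  obtain ⟨k, -, hk⟩ := hYb.1.mem_iff.1 (hV.mem_nhds (hyV rfl))
  refine ⟨k, extendByZero (hYc k).compl (restrictFst _ f), fun x hx s =>
    extendByZero_of_notMem (hYc k).compl _ (fun h => h hx), ?_⟩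
  refine (ContinuousMap.norm_le _ hε.le).2 fun z => ?_
  rw [ContinuousMap.sub_apply]
  by_cases hz : z.1 ∈ Y k
  · rw [extendByZero_of_notMem (hYc k).compl _ (fun h => h hz), sub_zero]
    exact le_of_lt (hVW (show z ∈ V ×ˢ W from ⟨hk hz, hSW (Set.mem_univ _)⟩))
  · rw [extendByZero_of_mem (hYc k).compl _ hz]
    simpa [restrictFst] using hε.le

/-- The orbit breaking algebra of a point is the closure of the union of those of a neighbourhood
basis of clopen sets. -/
theorem orbitBreaking_singleton_le (α : X ≃ₜ X) (β : S ≃ₜ S) {y : X} {Y : ℕ → Set X}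
    (hYc : ∀ k, IsClopen (Y k)) (hYb : (nhds y).HasAntitoneBasis Y) :
    orbitBreaking α β {y} ≤
      (⨆ k, (CrossedProduct.covariantPair (α.prodCongr β)).breaking (Y k)).topologicalClosure := by
  set P := CrossedProduct.covariantPair (α.prodCongr β)
  have hgen : ∀ k, ∀ a ∈ P.breaking (Y k), a ∈ ⨆ k, P.breaking (Y k) := fun k a ha =>
    le_iSup (fun k => P.breaking (Y k)) k ha
  refine StarSubalgebra.topologicalClosure_minimal (StarAlgebra.adjoin_le
    (Set.union_subset ?_ ?_)) (StarSubalgebra.isClosed_topologicalClosure _)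
  · rintro _ ⟨f, rfl⟩
    exact StarSubalgebra.le_topologicalClosure _
      (hgen 0 _ (StarAlgebra.subset_adjoin ℂ _ (Or.inl ⟨f, rfl⟩)))
  · rintro _ ⟨f, hf, rfl⟩
    refine Metric.mem_closure_iff.2 fun ε hε => ?_
    obtain ⟨k, g, hg, hfg⟩ := exists_norm_sub_le_of_hasAntitoneBasis hYc hYb f (hf y rfl)
      (half_pos hε)
    refine ⟨P.u * P.toHom g,
      hgen k _ (StarAlgebra.subset_adjoin ℂ _ (Or.inr ⟨g, hg, rfl⟩)), ?_⟩
    change dist (P.u * P.toHom f) (P.u * P.toHom g) < ε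
    rw [dist_eq_norm, ← mul_sub, ← map_sub,
      CStarRing.norm_mem_unitary_mul (U := P.u) _ (CrossedProduct.unitary_mem _)]
    exact ((NonUnitalStarAlgHom.norm_apply_le P.toHom (f - g)).trans hfg).trans_lt
      (half_lt_self hε)

/-- An injective `*`-homomorphism of C*-algebras is isometric, so its image is complete. -/
theorem MatrixSum.isClosed_range_of_injective {A : Type v} [CStarAlgebra A] {m : ℕ} {r : Fin m → ℕ}
    {Y : Fin m → Type u} [∀ i, TopologicalSpace (Y i)] [∀ i, CompactSpace (Y i)]
    (φ : MatrixSum r Y →⋆ₐ[ℂ] A) (hφ : Function.Injective φ) : IsClosed (Set.range φ) := by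
  let _ : ∀ i, PartialOrder C(Y i, ℂ) := fun i => CStarAlgebra.spectralOrder _
  have : ∀ i, StarOrderedRing C(Y i, ℂ) := fun i => CStarAlgebra.spectralOrderedRing _
  exact (NonUnitalStarAlgHom.isometry φ hφ).isClosedEmbedding.isClosed_range

theorem TowerPartition.isClosed_breaking {α : X ≃ₜ X} {β : S ≃ₜ S} {A : Type v}
    [CStarAlgebra A] (P : CovariantPair (α.prodCongr β) A) (hP : Function.Injective P.toHom)
    {Y : Set X} (T : TowerPartition α Y) : IsClosed (P.breaking Y : Set A) := by
  have : ∀ i, CompactSpace (T.U i) := fun i =>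
    isCompact_iff_compactSpace.1 (T.isClopen i).isClosed.isCompact
  rw [← T.range_towerHom P]
  exact MatrixSum.isClosed_range_of_injective (T.towerHom P) (T.towerHom_injective P hP)

/-- A C*-algebra that is the closure of an increasing sequence of orbit breaking algebras of tops
of Kakutani-Rokhlin partitions is an inductive limit of matrix algebras over `U × S`, `U` clopen. -/
theorem CovariantPair.exists_isInductiveLimit {α : X ≃ₜ X} {β : S ≃ₜ S} {A : Type u}
    [CStarAlgebra A] (P : CovariantPair (α.prodCongr β) A) (hP : Function.Injective P.toHom)
    {Y : ℕ → Set X} (hY : Antitone Y) (T : ∀ k, TowerPartition α (Y k)) (D : StarSubalgebra ℂ A)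
    [IsClosed (D : Set A)] (hle : ∀ k, P.breaking (Y k) ≤ D)
    (hD : D ≤ (⨆ k, P.breaking (Y k)).topologicalClosure) :
    ∃ B : ℕ → StarSubalgebra ℂ D, IsInductiveLimit D B ∧
      ∀ k, ∃ (m : ℕ) (h : Fin m → ℕ) (U : Fin m → Set X),
        (∀ i, 0 < h i ∧ IsClopen (U i) ∧ (U i).Nonempty) ∧
        Nonempty (B k ≃⋆ₐ[ℂ] MatrixSum h (fun i => U i × S)) := by
  refine ⟨fun k => (P.breaking (Y k)).comap D.subtype, ⟨?_, ?_, ?_⟩, fun k => ⟨(T k).m, (T k).h,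
    (T k).U, fun i => ⟨(T k).h_pos i, (T k).isClopen i, (T k).nonempty i⟩, ?_⟩⟩
  · exact fun k => ((T k).isClosed_breaking P hP).preimage continuous_subtype_val
  · exact fun k l hkl x hx => P.breaking_antitone (hY hkl) hx
  -- The supremum of a directed family of subalgebras is its union, so `hD` is already the density
  -- statement, read in `A`.
  · refine Subtype.dense_iff.2 fun x hx => closure_mono ?_ (hD hx)
    intro a ha
    obtain ⟨k, hk⟩ := Set.mem_iUnion.1 ((P.coe_iSup_breaking hY).le ha)
    exact ⟨⟨a, hle k hk⟩, Set.mem_iUnion.2 ⟨k, hk⟩, rfl⟩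
  · exact (T k).nonempty_starAlgEquiv P hP D (hle k)

/-- The orbit breaking algebra of a point for a minimal homeomorphism of a compact metrizable
zero-dimensional space is an inductive limit of matrix algebras over `U × S`, `U` clopen. -/
theorem exists_isInductiveLimit_orbitBreaking [TopologicalSpace.MetrizableSpace X]
    [TotallyDisconnectedSpace X] {α : X ≃ₜ X} (hα : IsMinimalHomeo α) (β : S ≃ₜ S) (y : X) :
    ∃ B : ℕ → StarSubalgebra ℂ (orbitBreaking α β {y}),
      IsInductiveLimit (orbitBreaking α β {y}) B ∧
      ∀ k, ∃ (m : ℕ) (h : Fin m → ℕ) (U : Fin m → Set X),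
        (∀ i, 0 < h i ∧ IsClopen (U i) ∧ (U i).Nonempty) ∧
        Nonempty (B k ≃⋆ₐ[ℂ] MatrixSum h (fun i => U i × S)) := by
  obtain ⟨Y, hYc, hYb⟩ := (nhds_basis_clopen y).exists_antitone_subbasis
  have T : ∀ k, TowerPartition α (Y k) := fun k =>
    (hα.nonempty_towerPartition (hYc k).2 ⟨y, (hYc k).1⟩).some
  exact (CrossedProduct.covariantPair (α.prodCongr β)).exists_isInductiveLimit
    (CrossedProduct.ofFunHom_injective _) hYb.antitone T (orbitBreaking α β {y})
    (fun k => (CovariantPair.breaking_antitone _ (Set.singleton_subset_iff.2 (hYc k).1)).trans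
      (StarSubalgebra.le_topologicalClosure _))
    (orbitBreaking_singleton_le α β (fun k => (hYc k).2) hYb)

end OrbitBreaking

/-- Full matrix algebras are the corners cut out by the projection `1`. -/
theorem isHomogeneousSumOfDimLE_of_starAlgEquiv {A : Type u} [CStarAlgebra A]
    {B : StarSubalgebra ℂ A} {m : ℕ} {r : Fin m → ℕ} {Y : Fin m → Type u}
    [∀ i, TopologicalSpace (Y i)] {d : ℕ} (hY : ∀ i, CompactSpace (Y i) ∧
      TopologicalSpace.MetrizableSpace (Y i) ∧ CoveringDimLE (Y i) d)
    (e : B ≃⋆ₐ[ℂ] MatrixSum r Y) : IsHomogeneousSumOfDimLE d B := by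
  refine ⟨m, r, Y, inferInstance, hY, 1, .one (MatrixSum r Y), ?_⟩
  refine ⟨{ toFun := e
            map_smul' := fun c a => map_smul e c a
            map_zero' := map_zero e
            map_add' := map_add e
            map_mul' := map_mul e
            map_star' := map_star e }, e.injective, ?_⟩
  ext a
  simp

theorem proposition1p3 (n : ℕ) (hn : 3 ≤ n) (hodd : Odd n)
    (X : Type u) [TopologicalSpace X] [CompactSpace X] [TopologicalSpace.MetrizableSpace X]
    [TotallyDisconnectedSpace X] [PerfectSpace X]
    (α : X ≃ₜ X) (hα : IsMinimalHomeo α) (β : UnitSphere n ≃ₜ UnitSphere n) (y : X) :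
    (∃ B : ℕ → StarSubalgebra ℂ (orbitBreaking α β {y}),
      IsInductiveLimit (orbitBreaking α β {y}) B ∧
      ∀ k, ∃ (m : ℕ) (h : Fin m → ℕ) (U : Fin m → Set X),
        (∀ i, 0 < h i ∧ IsClopen (U i) ∧ (U i).Nonempty) ∧
        Nonempty (B k ≃⋆ₐ[ℂ] MatrixSum h (fun i => U i × UnitSphere n))) ∧
    IsAHNoDimGrowth (orbitBreaking α β {y}) := by
  have hlim := exists_isInductiveLimit_orbitBreaking hα β y
  obtain ⟨B, hB, hBk⟩ := hlim
  refine ⟨⟨B, hB, hBk⟩, 2 ^ (n + 1), B, hB, fun k => ?_⟩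
  obtain ⟨m, h, U, hU, ⟨e⟩⟩ := hBk k
  refine isHomogeneousSumOfDimLE_of_starAlgEquiv (fun i => ?_) e
  have : CompactSpace (U i) := isCompact_iff_compactSpace.1 (hU i).2.1.isClosed.isCompact
  exact ⟨inferInstance, inferInstance, coveringDimLE_prod_unitSphere n⟩
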